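/- Let $0<p\le 1$ and let $A$ be a complex uniform $p$-Banach algebra with unit, that is, an associative unital complex algebra with a map $\|\cdot\|:A\to[0,\infty)$ such that, for all $a,b\in A$ and $\alpha\in\mathbb C$, $\|a+b\|\le\|a\|+\|b\|$, $\|\alpha a\|=|\alpha|^p\|a\|$, $\|a\|=0$ only if $a=0$, $\|ab\|\le\|a\|\,\|b\|$ and $\|a^2\|=\|a\|^2$, and such that $A$ is complete for the metric $\|a-b\|$. Let $$|a|=\inf\Bigl\{\sum_{i=1}^n\|a_i\|^{1/p} : n\ge 1,\ a_1,\dots,a_n\in A,\ a=\sum_{i=1}^n a_i\Bigr\}$$ be the support seminorm of $\|\cdot\|$. Let $M(A)$ be the set of all nonzero continuous multiplicative linear functionals on $A$, with the topology of pointwise convergence on $A$. Then $M(A)$ is compact, and the Gelfand map $G:A\to C(M(A))$, $G(a)(f)=f(a)$, is an injective homomorphism of unital complex algebras such that $$|a|=\|a\|^{1/p}=\|G(a)\|_s\qquad\text{for all }a\in A,$$ where $\|\cdot\|_s$ is the sup norm on the algebra $C(M(A))$ of continuous complex functions on $M(A)$. -/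

import Mathlib

/-- A normed ring `A` that is a complex algebra is a complex `p`-normed algebra when `0 < p ≤ 1` and
its norm is `p`-homogeneous. Subadditivity, definiteness and submultiplicativity of the norm, and
the metric `‖a - b‖`, are part of `NormedRing`, which asks for no homogeneity of its own. -/
structure IsPNormedAlgebra (p : ℝ) (A : Type*) [NormedRing A] [Algebra ℂ A] : Prop where
  p_pos : 0 < p
  p_le_one : p ≤ 1
  norm_smul : ∀ (c : ℂ) (a : A), ‖c • a‖ = ‖c‖ ^ p * ‖a‖

/-- A complex uniform `p`-Banach algebra: a complete complex `p`-normed algebra whose norm has the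
square property. -/
structure IsUniformPBanachAlgebra (p : ℝ) (A : Type*) [NormedRing A] [Algebra ℂ A] : Prop
    extends IsPNormedAlgebra p A where
  complete : CompleteSpace A
  norm_sq : ∀ a : A, ‖a ^ 2‖ = ‖a‖ ^ 2

/-- The support seminorm `|a|` of a `p`-homogeneous norm: the infimum of `∑ i, ‖b i‖ ^ (1 / p)` over
all decompositions `a = ∑ i, b i` of `a` as a finite sum. -/
noncomputable def supportSeminorm (p : ℝ) {A : Type*} [NormedRing A] (a : A) : ℝ :=
  sInf {s : ℝ | ∃ (n : ℕ) (b : Fin n → A), 1 ≤ n ∧ a = ∑ i, b i ∧ s = ∑ i, ‖b i‖ ^ (1 / p)}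

open Finset Filter Topology

/-! The aim is to show that `‖a‖ ^ (1 / p)` is a Banach algebra norm with the square property;
classical Gelfand theory then applies. Commutativity comes first. The square property makes the norm
invariant under similarity, so `exp(za) b exp(-za)` is a bounded entire function of `z`. By a
Liouville theorem for `p`-norms it is constant, and its linear coefficient `ab - ba` vanishes. In a
commutative algebra, expanding `(a + b) ^ n` for `n = 2 ^ m` and taking `n`-th roots gives the
triangle inequality for `‖a‖ ^ (1 / p)`. Hence this is also the support seminorm. -/

theorem le_of_forall_pow_two_pow_le {X Y C : ℝ} (hY : 0 ≤ Y)
    (h : ∀ m : ℕ, X ^ (2 ^ m) ≤ C * ((2 ^ m : ℕ) + 1) * Y ^ (2 ^ m)) : X ≤ Y := by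
  by_contra! hlt
  have hXpos : 0 < X := hY.trans_lt hlt
  have hr0 : 0 ≤ Y / X := by positivity
  have hr1 : Y / X < 1 := (div_lt_one hXpos).2 hlt
  -- With `r = Y / X < 1` and `n = 2 ^ m`, the hypothesis says `1 ≤ C (n + 1) r ^ n`, which tends to
  -- `0`.
  have t1 := tendsto_self_mul_const_pow_of_lt_one hr0 hr1
  have t2 := tendsto_pow_atTop_nhds_zero_of_lt_one hr0 hr1
  have t3 := ((t1.add t2).const_mul C).comp (tendsto_pow_atTop_atTop_of_one_lt (one_lt_two (α := ℕ)))
  have h1 : (1 : ℝ) ≤ C * (0 + 0) := by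
    refine ge_of_tendsto' t3 fun m ↦ ?_
    have := h m
    simp only [Function.comp_apply, div_pow]
    have hp : 0 < X ^ 2 ^ m := by positivity
    rw [← sub_nonneg]
    have e : C * ((2 ^ m : ℕ) * (Y ^ 2 ^ m / X ^ 2 ^ m) + Y ^ 2 ^ m / X ^ 2 ^ m) - 1
      = (C * ((2 ^ m : ℕ) + 1) * Y ^ (2 ^ m) - X ^ 2 ^ m) / X ^ 2 ^ m := by
      field_simp
    rw [e]
    exact div_nonneg (by linarith) hp.le
  norm_num at h1

/-- Powers of `n` are beaten by `p`-th powers of factorials, uniformly in a dilation. -/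
theorem exists_forall_pow_le_factorial_rpow {p : ℝ} (hp : 0 < p) {X : ℝ} (hX : 0 ≤ X) :
    ∃ K : ℕ, 0 < K ∧ ∀ R n : ℕ, K * R ≤ n → (X * (R : ℝ) ^ p) ^ n ≤ (n.factorial : ℝ) ^ p := by
  -- From `n! ≥ (n / e) ^ n`: it suffices that `n ≥ e X ^ (1 / p) R`, a threshold linear in `R`.
  obtain ⟨K, hK⟩ := exists_nat_ge (Real.exp 1 * X ^ (1 / p))
  refine ⟨K + 1, K.succ_pos, fun R n hn ↦ ?_⟩
  set Y : ℝ := X ^ (1 / p) * R with hYdef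
  have hY0 : 0 ≤ Y := by positivity
  have hYp : X * (R : ℝ) ^ p = Y ^ p := by
    rw [hYdef, Real.mul_rpow (by positivity) (by positivity), ← Real.rpow_mul hX,
      one_div_mul_cancel hp.ne', Real.rpow_one]
  have hYn : Real.exp 1 * Y ≤ n := by
    have h1 : ((K + 1 : ℕ) * R : ℝ) ≤ n := by exact_mod_cast hn
    push_cast at h1
    have h2 : Real.exp 1 * X ^ (1 / p) * R ≤ K * R :=
      mul_le_mul_of_nonneg_right hK (by positivity)
    have : (0 : ℝ) ≤ R := by positivity
    rw [hYdef]
    linarith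
  have hfac : Y ^ n ≤ n.factorial := by
    have h1 := Real.pow_div_factorial_le_exp (n : ℝ) (by positivity) n
    have h2 : (Real.exp 1 * Y) ^ n ≤ (n : ℝ) ^ n := pow_le_pow_left₀ (by positivity) hYn n
    rw [div_le_iff₀ (by positivity), ← mul_one (n : ℝ), Real.exp_nat_mul, mul_one] at h1
    rw [mul_pow] at h2
    exact le_of_mul_le_mul_left (h2.trans h1) (by positivity)
  rw [hYp, ← Real.rpow_natCast, ← Real.rpow_mul hY0, mul_comm p, Real.rpow_mul hY0,
    Real.rpow_natCast]
  exact Real.rpow_le_rpow (by positivity) hfac hp.le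

theorem summable_pow_div_factorial_rpow {p : ℝ} (hp : 0 < p) {X : ℝ} (hX : 0 ≤ X) :
    Summable fun n : ℕ ↦ X ^ n / (n.factorial : ℝ) ^ p := by
  obtain ⟨K, -, hK⟩ := exists_forall_pow_le_factorial_rpow hp (X := 2 * X) (by positivity)
  refine summable_of_isBigO_nat (g := fun n ↦ (1 / 2 : ℝ) ^ n) summable_geometric_two
    (Asymptotics.IsBigO.of_bound 1 ?_)
  filter_upwards [Filter.eventually_ge_atTop K] with n hn
  have h1 := hK 1 n (by simpa using hn)
  rw [Nat.cast_one, Real.one_rpow, mul_one, mul_pow] at h1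
  have hf : (0 : ℝ) < (n.factorial : ℝ) ^ p := by positivity
  rw [Real.norm_of_nonneg (by positivity), Real.norm_of_nonneg (by positivity), one_mul,
    div_le_iff₀ hf, one_div, inv_pow, ← div_eq_inv_mul, le_div_iff₀ (by positivity)]
  linarith

/-! ### Liouville's theorem for `p`-norms -/

namespace IsPNormedAlgebra

variable {p : ℝ} {A : Type*} [NormedRing A] [Algebra ℂ A]

theorem continuousConstSMul : ContinuousConstSMul ℂ A :=
  ⟨fun c ↦ by
    simpa only [Algebra.smul_def] using continuous_const_mul (algebraMap ℂ A c)⟩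

/-- A sum over `N`-th roots of unity replaces Cauchy's integral: among the indices below `N` it
isolates `j`, at the cost of a factor `N` and a tail. -/
theorem norm_le_mul_of_forall_norm_tsum_le [CompleteSpace A] (h : IsPNormedAlgebra p A)
    {d : ℕ → A} (hd : Summable fun n ↦ ‖d n‖) {M : ℝ}
    (hM : ∀ z : ℂ, ‖z‖ = 1 → ‖∑' n, z ^ n • d n‖ ≤ M) {N j : ℕ} (hj : j < N) :
    ‖d j‖ ≤ N * (M + ∑' n, ‖d (n + N)‖) := by
  have : ContinuousConstSMul ℂ A := continuousConstSMul
  have hN : 0 < N := by omega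
  have hN1 : (1 : ℝ) ≤ N := by exact_mod_cast hN
  set ζ : ℂ := Complex.exp (2 * Real.pi * Complex.I / N) with hζdef
  have hζ : IsPrimitiveRoot ζ N := Complex.isPrimitiveRoot_exp N hN.ne'
  have hζn : ‖ζ‖ = 1 := hζ.norm'_eq_one hN.ne'
  have hz (k : ℕ) : ‖ζ ^ k‖ = 1 := by rw [norm_pow, hζn, one_pow]
  -- The exponent `N - j` stands for `-j`, as `ζ ^ N = 1`.
  set s : ℕ → ℂ := fun n ↦ ∑ k ∈ range N, (ζ ^ k) ^ (N - j) * (ζ ^ k) ^ n with hs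
  have hsn (n : ℕ) : ‖s n‖ ≤ N := by
    refine (norm_sum_le _ _).trans ?_
    simp [hζn]
  have hsgeom (n : ℕ) : s n = ∑ k ∈ range N, (ζ ^ (N - j + n)) ^ k := by
    refine sum_congr rfl fun k _ ↦ ?_
    rw [← pow_add, ← pow_mul, ← pow_mul, mul_comm]
  have hsj : s j = N := by
    rw [hsgeom, Nat.sub_add_cancel hj.le, hζ.pow_eq_one]
    simp
  have hs0 (n : ℕ) (hn : n < N) (hnj : n ≠ j) : s n = 0 := by
    rw [hsgeom]
    have hne : ζ ^ (N - j + n) ≠ 1 := by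
      rw [Ne, hζ.pow_eq_one_iff_dvd]
      rintro ⟨t, ht⟩
      have h2 : N * t < N * 2 := by omega
      have h3 : t < 2 := lt_of_mul_lt_mul_left h2 (Nat.zero_le _)
      interval_cases t <;> omega
    have := geom_sum_eq hne N
    rw [this, ← pow_mul, mul_comm, pow_mul, hζ.pow_eq_one, one_pow, sub_self, zero_div]
  have hNp : (N : ℝ) ^ p ≤ N := by
    simpa using Real.rpow_le_rpow_of_exponent_le hN1 h.p_le_one
  have hsmul (n m : ℕ) : ‖s n • d m‖ ≤ N * ‖d m‖ := by
    rw [h.norm_smul]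
    gcongr
    exact (Real.rpow_le_rpow (norm_nonneg _) (hsn n) h.p_pos.le).trans hNp
  have hsumz (z : ℂ) (hz1 : ‖z‖ = 1) : Summable fun n ↦ z ^ n • d n := by
    refine Summable.of_norm (hd.congr fun n ↦ ?_)
    rw [h.norm_smul, norm_pow, hz1, one_pow, Real.one_rpow, one_mul]
  have hsums : Summable fun n ↦ s n • d n :=
    Summable.of_norm_bounded (hd.mul_left (N : ℝ)) fun n ↦ hsmul n n
  have htail : Summable fun n ↦ ‖d (n + N)‖ := (summable_nat_add_iff N).2 hd
  have key : ∑ k ∈ range N, (ζ ^ k) ^ (N - j) • ∑' n, (ζ ^ k) ^ n • d n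
      = (N : ℂ) • d j + ∑' n, s (n + N) • d (n + N) := by
    have e1 : ∑ k ∈ range N, (ζ ^ k) ^ (N - j) • ∑' n, (ζ ^ k) ^ n • d n = ∑' n, s n • d n := by
      simp_rw [← (hsumz _ (hz _)).tsum_const_smul]
      rw [← Summable.tsum_finsetSum fun k _ ↦ (hsumz _ (hz k)).const_smul _]
      refine tsum_congr fun n ↦ ?_
      simp_rw [smul_smul, hs, sum_smul]
    rw [e1, ← hsums.sum_add_tsum_nat_add N]
    congr 1
    rw [sum_eq_single_of_mem j (mem_range.2 hj), hsj]
    intro n hn hnj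
    rw [hs0 n (mem_range.1 hn) hnj, zero_smul]
  have b1 : ‖∑ k ∈ range N, (ζ ^ k) ^ (N - j) • ∑' n, (ζ ^ k) ^ n • d n‖ ≤ N * M := by
    refine (norm_sum_le_of_le (n := fun _ ↦ M) _ fun k _ ↦ ?_).trans_eq ?_
    · rw [h.norm_smul, norm_pow, hz, one_pow, Real.one_rpow, one_mul]
      exact hM _ (hz k)
    · simp
  have b2 : ‖∑' n, s (n + N) • d (n + N)‖ ≤ N * ∑' n, ‖d (n + N)‖ := by
    rw [← tsum_mul_left]
    exact tsum_of_norm_bounded (htail.mul_left _).hasSum fun n ↦ hsmul _ _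
  have b3 : ‖d j‖ ≤ ‖(N : ℂ) • d j‖ := by
    rw [h.norm_smul, Complex.norm_natCast]
    exact le_mul_of_one_le_left (norm_nonneg _) (Real.one_le_rpow hN1 h.p_pos.le)
  rw [eq_comm, ← eq_sub_iff_add_eq] at key
  rw [key] at b3
  calc ‖d j‖ ≤ _ := b3
    _ ≤ _ := norm_sub_le _ _
    _ ≤ N * M + N * ∑' n, ‖d (n + N)‖ := add_le_add b1 b2
    _ = _ := by ring

/-- **Liouville's theorem** for entire functions of exponential type with values in a complete
`p`-normed algebra. -/
theorem eq_zero_of_forall_norm_tsum_le [CompleteSpace A] (h : IsPNormedAlgebra p A)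
    {c : ℕ → A} {B X M : ℝ} (hB : 0 ≤ B) (hX : 0 ≤ X)
    (hc : ∀ n, ‖c n‖ ≤ B * (X ^ n / (n.factorial : ℝ) ^ p))
    (hM : ∀ z : ℂ, ‖∑' n, z ^ n • c n‖ ≤ M) {j : ℕ} (hj : 0 < j) : c j = 0 := by
  have hp := h.p_pos
  have hdn (R n : ℕ) : ‖((R : ℂ) ^ n) • c n‖ = ((R : ℝ) ^ p) ^ n * ‖c n‖ := by
    rw [h.norm_smul, norm_pow, Complex.norm_natCast, ← Real.rpow_natCast, ← Real.rpow_mul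
      (by positivity), mul_comm, mul_comm (n : ℝ), Real.rpow_mul (by positivity), Real.rpow_natCast,
      mul_comm]
  have hdb (R n : ℕ) : ‖((R : ℂ) ^ n) • c n‖
      ≤ B * ((X * (R : ℝ) ^ p) ^ n / (n.factorial : ℝ) ^ p) := by
    rw [hdn]
    calc _ ≤ ((R : ℝ) ^ p) ^ n * (B * (X ^ n / (n.factorial : ℝ) ^ p)) := by gcongr; exact hc n
      _ = _ := by rw [mul_pow]; ring
  have hsum (R : ℕ) : Summable fun n ↦ ‖((R : ℂ) ^ n) • c n‖ :=
    Summable.of_nonneg_of_le (fun _ ↦ norm_nonneg _) (hdb R)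
      ((summable_pow_div_factorial_rpow hp (by positivity)).mul_left B)
  have hbd (R : ℕ) (z : ℂ) : ‖∑' n, z ^ n • ((R : ℂ) ^ n) • c n‖ ≤ M := by
    simpa only [smul_smul, ← mul_pow] using hM (z * R)
  have core (R N i : ℕ) (hi : i < N) : ((R : ℝ) ^ p) ^ i * ‖c i‖
      ≤ N * (M + ∑' n, ‖((R : ℂ) ^ (n + N)) • c (n + N)‖) := by
    rw [← hdn]
    exact h.norm_le_mul_of_forall_norm_tsum_le (hsum R) (fun z _ ↦ hbd R z) hi
  have tendsR : Filter.Tendsto (fun R : ℕ ↦ (R : ℝ) ^ p) Filter.atTop Filter.atTop :=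
    (tendsto_rpow_atTop hp).comp tendsto_natCast_atTop_atTop
  -- all coefficients of large order vanish
  have large : ∃ J : ℕ, ∀ i, J ≤ i → c i = 0 := by
    -- Taking `N = K * R` roots on the circle of radius `R` keeps the tail below `2 * B`. The loss
    -- is linear in `R`, so `p * i ≥ 2` suffices to beat it.
    obtain ⟨K, hK0, hK⟩ := exists_forall_pow_le_factorial_rpow hp (X := 2 * X) (by positivity)
    obtain ⟨J, hJ⟩ := exists_nat_ge (2 / p)
    refine ⟨J, fun i hi ↦ ?_⟩
    have hip : 2 ≤ p * i := by
      have : (J : ℝ) ≤ i := by exact_mod_cast hi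
      rw [mul_comm, ← div_le_iff₀ hp]
      linarith
    have hbound : ∀ R : ℕ, i < R → (R : ℝ) * ‖c i‖ ≤ K * (M + 2 * B) := by
      intro R hR
      have hR0 : (0 : ℝ) < R := by exact_mod_cast (Nat.zero_le i).trans_lt hR
      have hR1 : (1 : ℝ) ≤ R := by exact_mod_cast (Nat.zero_le i).trans_lt hR
      have h1 := core R (K * R) i (hR.trans_le (Nat.le_mul_of_pos_left R hK0))
      have htail : ∑' n, ‖((R : ℂ) ^ (n + K * R)) • c (n + K * R)‖ ≤ 2 * B := by
        have hle (n : ℕ) : ‖((R : ℂ) ^ (n + K * R)) • c (n + K * R)‖ ≤ B * (1 / 2) ^ n := by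
          refine (hdb R _).trans ?_
          gcongr
          have h2 := hK R (n + K * R) (Nat.le_add_left _ _)
          rw [mul_assoc, mul_pow] at h2
          rw [div_le_iff₀ (by positivity), one_div, inv_pow, ← div_eq_inv_mul,
            le_div_iff₀ (by positivity), mul_comm]
          refine le_trans ?_ h2
          gcongr
          · norm_num
          · exact Nat.le_add_right _ _
        refine (((summable_nat_add_iff (K * R)).2 (hsum R)).tsum_le_tsum hle
          (summable_geometric_two.mul_left B)).trans_eq ?_
        rw [tsum_mul_left, tsum_geometric_two, mul_comm]
      have h3 : (R : ℝ) ^ 2 ≤ ((R : ℝ) ^ p) ^ i := by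
        rw [← Real.rpow_natCast (R ^ p), ← Real.rpow_mul hR0.le, ← Real.rpow_natCast]
        exact Real.rpow_le_rpow_of_exponent_le hR1 (by exact_mod_cast hip)
      have h4 : (R : ℝ) * (R * ‖c i‖) ≤ R * (K * (M + 2 * B)) := by
        calc (R : ℝ) * (R * ‖c i‖) = R ^ 2 * ‖c i‖ := by ring
          _ ≤ ((R : ℝ) ^ p) ^ i * ‖c i‖ := by gcongr
          _ ≤ _ := h1
          _ ≤ (K * R : ℕ) * (M + 2 * B) := by gcongr
          _ = _ := by push_cast; ring
      exact le_of_mul_le_mul_left h4 hR0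
    by_contra hne
    have hpos : 0 < ‖c i‖ := norm_pos_iff.2 hne
    obtain ⟨R, hR1, hR2⟩ := ((tendsto_natCast_atTop_atTop (R := ℝ)).atTop_mul_const hpos
      |>.eventually_gt_atTop (K * (M + 2 * B)) |>.and (Filter.eventually_gt_atTop i)).exists
    exact absurd (hbound R hR2) (not_le.2 hR1)
  obtain ⟨J, hJ⟩ := large
  by_contra hne
  have hpos : 0 < ‖c j‖ := norm_pos_iff.2 hne
  -- The series is now a polynomial: `N = J + j + 1` stays fixed, there is no tail, and `R → ∞`.
  obtain ⟨R, hR1, hR2⟩ := (tendsR.atTop_mul_const hpos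
    |>.eventually_gt_atTop ((J + j + 1 : ℕ) * M) |>.and
      (tendsR.eventually_ge_atTop 1)).exists
  have h1 := core R (J + j + 1) j (by omega)
  have h2 : ∑' n, ‖((R : ℂ) ^ (n + (J + j + 1))) • c (n + (J + j + 1))‖ = 0 := by
    have : ∀ n, c (n + (J + j + 1)) = 0 := fun n ↦ hJ _ (by omega)
    simp [this]
  rw [h2, add_zero] at h1
  have h3 : (R : ℝ) ^ p ≤ ((R : ℝ) ^ p) ^ j := le_self_pow₀ hR2 hj.ne'
  have h4 := mul_le_mul_of_nonneg_right h3 hpos.le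
  linarith

end IsPNormedAlgebra

/-! ### Exponentials and commutativity -/

/-- The `n`-th term `a ^ n / n!` of the exponential series. -/
noncomputable def expTerm {A : Type*} [Ring A] [Algebra ℂ A] (n : ℕ) (a : A) : A :=
  ((n.factorial : ℂ)⁻¹) • a ^ n

theorem expTerm_smul {A : Type*} [Ring A] [Algebra ℂ A] (n : ℕ) (z : ℂ) (a : A) :
    expTerm n (z • a) = z ^ n • expTerm n a := by
  rw [expTerm, expTerm, smul_pow, smul_comm]

theorem sum_expTerm_mul_expTerm_neg {A : Type*} [Ring A] [Algebra ℂ A] (a : A) (n : ℕ) :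
    ∑ kl ∈ antidiagonal n, expTerm kl.1 a * expTerm kl.2 (-a) = if n = 0 then 1 else 0 := by
  have h1 : ∑ kl ∈ antidiagonal n, expTerm kl.1 a * expTerm kl.2 (-a)
      = (n.factorial : ℂ)⁻¹ • (a + -a) ^ n := by
    rw [((Commute.refl a).neg_right).add_pow', smul_sum]
    refine sum_congr rfl fun kl hkl ↦ ?_
    rw [← mem_antidiagonal.1 hkl, expTerm, expTerm, smul_mul_smul_comm, ← Nat.cast_smul_eq_nsmul ℂ,
      smul_smul, Nat.choose_symm_add, Nat.add_choose, Nat.cast_div (Nat.factorial_mul_factorial_dvd_factorial_add _ _)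
      (Nat.cast_ne_zero.2 (by positivity))]
    congr 1
    have := Nat.cast_ne_zero (R := ℂ).2 (kl.1 + kl.2).factorial_ne_zero
    push_cast
    field_simp
  rw [h1, add_neg_cancel]
  split_ifs with hn
  · simp [hn]
  · simp [hn]

namespace IsUniformPBanachAlgebra

variable {p : ℝ} {A : Type*} [NormedRing A] [Algebra ℂ A]

theorem norm_pow_two_pow (h : IsUniformPBanachAlgebra p A) (a : A) (m : ℕ) :
    ‖a ^ (2 ^ m)‖ = ‖a‖ ^ (2 ^ m) := by
  induction m with
  | zero => simp
  | succ m ih => rw [pow_succ, pow_mul, h.norm_sq, ih, pow_mul]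

theorem norm_one_le (h : IsUniformPBanachAlgebra p A) : ‖(1 : A)‖ ≤ 1 := by
  have := h.norm_sq 1
  rw [one_pow] at this
  nlinarith [norm_nonneg (1 : A)]

theorem norm_pow_le_pow (h : IsUniformPBanachAlgebra p A) (a : A) (n : ℕ) :
    ‖a ^ n‖ ≤ ‖a‖ ^ n := by
  cases n with
  | zero => simpa using h.norm_one_le
  | succ n => exact norm_pow_le' a n.succ_pos

/-- The norm is invariant under similarity. -/
theorem norm_conj_le (h : IsUniformPBanachAlgebra p A) {u v : A} (huv : v * u = 1) (b : A) :
    ‖u * b * v‖ ≤ ‖b‖ := by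
  have hpow (n : ℕ) : (u * b * v) ^ (n + 1) = u * b ^ (n + 1) * v := by
    induction n with
    | zero => simp
    | succ n ih =>
      rw [pow_succ, ih, pow_succ b (n + 1)]
      calc u * b ^ (n + 1) * v * (u * b * v) = u * b ^ (n + 1) * (v * u) * b * v := by
            noncomm_ring
        _ = _ := by rw [huv]; noncomm_ring
  -- As `(u b v) ^ n = u b ^ n v`, the constant `‖u‖ * ‖v‖` disappears under `n`-th roots.
  refine le_of_forall_pow_two_pow_le (C := ‖u‖ * ‖v‖) (norm_nonneg _) fun m ↦ ?_
  obtain ⟨n, hn⟩ : ∃ n, 2 ^ m = n + 1 := Nat.exists_eq_succ_of_ne_zero (by positivity)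
  rw [← h.norm_pow_two_pow, hn, hpow, ← hn]
  calc ‖u * b ^ 2 ^ m * v‖ ≤ ‖u‖ * ‖b ^ 2 ^ m‖ * ‖v‖ :=
        (norm_mul_le _ _).trans (by gcongr; exact norm_mul_le _ _)
    _ = ‖u‖ * ‖v‖ * 1 * ‖b‖ ^ 2 ^ m := by rw [h.norm_pow_two_pow]; ring
    _ ≤ _ := by
      gcongr
      simp

theorem norm_expTerm_le (h : IsUniformPBanachAlgebra p A) (n : ℕ) (a : A) :
    ‖expTerm n a‖ ≤ ‖a‖ ^ n / (n.factorial : ℝ) ^ p := by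
  rw [expTerm, h.norm_smul, norm_inv, Complex.norm_natCast, Real.inv_rpow (by positivity),
    ← div_eq_inv_mul]
  gcongr
  exact h.norm_pow_le_pow a n

theorem summable_norm_expTerm (h : IsUniformPBanachAlgebra p A) (a : A) :
    Summable fun n ↦ ‖expTerm n a‖ :=
  Summable.of_nonneg_of_le (fun _ ↦ norm_nonneg _) (fun n ↦ h.norm_expTerm_le n a)
    (summable_pow_div_factorial_rpow h.p_pos (norm_nonneg a))

theorem tsum_expTerm_neg_mul (h : IsUniformPBanachAlgebra p A) (a : A) :
    (∑' n, expTerm n (-a)) * ∑' n, expTerm n a = 1 := by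
  have := h.complete
  rw [tsum_mul_tsum_eq_tsum_sum_antidiagonal_of_summable_norm (h.summable_norm_expTerm _)
    (h.summable_norm_expTerm _)]
  have := sum_expTerm_mul_expTerm_neg (-a)
  simp only [neg_neg] at this
  simp_rw [this]
  exact tsum_ite_eq 0 _

/-- These are the coefficients of `exp(za) b exp(-za)`. The `4` is `2 * 2`: `n! ≤ 2 ^ n k! l!`, and
there are `n + 1 ≤ 2 ^ n` terms. -/
theorem norm_sum_conj_expTerm_le (h : IsUniformPBanachAlgebra p A) (a b : A) (n : ℕ) :
    ‖∑ kl ∈ antidiagonal n, expTerm kl.1 a * b * expTerm kl.2 (-a)‖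
      ≤ ‖b‖ * ((4 * ‖a‖) ^ n / (n.factorial : ℝ) ^ p) := by
  have hp := h.p_pos
  have hterm : ∀ kl ∈ antidiagonal n, ‖expTerm kl.1 a * b * expTerm kl.2 (-a)‖
      ≤ ‖b‖ * ((2 * ‖a‖) ^ n / (n.factorial : ℝ) ^ p) := by
    rintro ⟨k, l⟩ hkl
    rw [HasAntidiagonal.mem_antidiagonal] at hkl
    simp only at hkl ⊢
    have hfac : (n.factorial : ℝ) ^ p ≤ 2 ^ n * ((k.factorial : ℝ) ^ p * (l.factorial : ℝ) ^ p) := by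
      have h1 : (n.factorial : ℝ) ≤ 2 ^ n * (k.factorial * l.factorial) := by
        have h2 := Nat.add_choose_mul_factorial_mul_factorial k l
        have h3 := Nat.choose_le_two_pow n l
        rw [hkl] at h2
        rw [← h2, mul_assoc]
        exact_mod_cast Nat.mul_le_mul_right _ h3
      calc (n.factorial : ℝ) ^ p ≤ (2 ^ n * (k.factorial * l.factorial)) ^ p := by gcongr
        _ = (2 ^ n : ℝ) ^ p * ((k.factorial : ℝ) ^ p * (l.factorial : ℝ) ^ p) := by
          rw [Real.mul_rpow (by positivity) (by positivity),
            Real.mul_rpow (by positivity) (by positivity)]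
        _ ≤ _ := by
          gcongr
          simpa using Real.rpow_le_rpow_of_exponent_le
            (one_le_pow₀ (one_le_two (α := ℝ)) (n := n)) h.p_le_one
    calc ‖expTerm k a * b * expTerm l (-a)‖ ≤ ‖expTerm k a‖ * ‖b‖ * ‖expTerm l (-a)‖ :=
          (norm_mul_le _ _).trans (by gcongr; exact norm_mul_le _ _)
      _ ≤ (‖a‖ ^ k / (k.factorial : ℝ) ^ p) * ‖b‖ * (‖-a‖ ^ l / (l.factorial : ℝ) ^ p) := by
        gcongr
        · exact h.norm_expTerm_le k a
        · exact h.norm_expTerm_le l (-a)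
      _ = ‖b‖ * (‖a‖ ^ n / ((k.factorial : ℝ) ^ p * (l.factorial : ℝ) ^ p)) := by
        rw [norm_neg, ← hkl, pow_add]
        field_simp
      _ ≤ _ := by
        refine mul_le_mul_of_nonneg_left ?_ (norm_nonneg b)
        rw [div_le_div_iff₀ (by positivity) (by positivity), mul_pow]
        calc ‖a‖ ^ n * (n.factorial : ℝ) ^ p
            ≤ ‖a‖ ^ n * (2 ^ n * ((k.factorial : ℝ) ^ p * (l.factorial : ℝ) ^ p)) := by gcongr
          _ = _ := by ring
  refine (norm_sum_le_of_le _ hterm).trans ?_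
  rw [sum_const, Nat.card_antidiagonal, nsmul_eq_mul]
  have h2 : ((n + 1 : ℕ) : ℝ) ≤ 2 ^ n := by exact_mod_cast Nat.lt_two_pow_self
  calc ((n + 1 : ℕ) : ℝ) * (‖b‖ * ((2 * ‖a‖) ^ n / (n.factorial : ℝ) ^ p))
      ≤ 2 ^ n * (‖b‖ * ((2 * ‖a‖) ^ n / (n.factorial : ℝ) ^ p)) := by gcongr
    _ = _ := by
      rw [show (4 : ℝ) * ‖a‖ = 2 * (2 * ‖a‖) by ring, mul_pow 2 (2 * ‖a‖)]
      ring

/-- A uniform `p`-Banach algebra is commutative. -/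
theorem mul_comm (h : IsUniformPBanachAlgebra p A) (a b : A) : a * b = b * a := by
  have hcomp := h.complete
  have hbound (z : ℂ) : ‖∑' n, z ^ n •
      ∑ kl ∈ antidiagonal n, expTerm kl.1 a * b * expTerm kl.2 (-a)‖ ≤ ‖b‖ := by
    have hsum : ∑' n, z ^ n • ∑ kl ∈ antidiagonal n, expTerm kl.1 a * b * expTerm kl.2 (-a)
        = (∑' n, expTerm n (z • a)) * b * ∑' n, expTerm n (-(z • a)) := by
      have hs : Summable fun n ↦ ‖expTerm n (z • a) * b‖ :=
        Summable.of_nonneg_of_le (fun _ ↦ norm_nonneg _) (fun n ↦ norm_mul_le _ _)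
          ((h.summable_norm_expTerm (z • a)).mul_right ‖b‖)
      rw [← (h.summable_norm_expTerm (z • a)).of_norm.tsum_mul_right,
        tsum_mul_tsum_eq_tsum_sum_antidiagonal_of_summable_norm hs (h.summable_norm_expTerm _)]
      refine tsum_congr fun n ↦ ?_
      rw [smul_sum]
      refine sum_congr rfl fun kl hkl ↦ ?_
      rw [← smul_neg, expTerm_smul, expTerm_smul, ← mem_antidiagonal.1 hkl, pow_add,
        smul_mul_assoc, smul_mul_smul_comm]
    rw [hsum]
    exact h.norm_conj_le (h.tsum_expTerm_neg_mul _) b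
  -- The coefficient of order one is `ab - ba`.
  have h1 := h.toIsPNormedAlgebra.eq_zero_of_forall_norm_tsum_le (norm_nonneg b) (by positivity)
    (h.norm_sum_conj_expTerm_le a b) hbound one_pos
  simp only [Nat.sum_antidiagonal_eq_sum_range_succ_mk, sum_range_succ, sum_range_one, expTerm,
    Nat.factorial, Nat.cast_one, inv_one, one_smul, pow_zero, one_mul, mul_one,
    pow_one, mul_neg, Nat.sub_zero, Nat.sub_self] at h1
  rw [neg_add_eq_zero] at h1
  exact h1.symm

/-! ### The norm `‖a‖ ^ (1 / p)` -/

/-- Each of the `n + 1` binomial terms of `(a + b) ^ n` has norm at most `((s + t) ^ n) ^ p`; the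
factor `n + 1` is lost under `n`-th roots. -/
theorem rpow_norm_add_le (h : IsUniformPBanachAlgebra p A) (a b : A) :
    ‖a + b‖ ^ (1 / p) ≤ ‖a‖ ^ (1 / p) + ‖b‖ ^ (1 / p) := by
  have hp := h.p_pos
  set s := ‖a‖ ^ (1 / p) with hs
  set t := ‖b‖ ^ (1 / p) with ht
  have hs0 : 0 ≤ s := by positivity
  have ht0 : 0 ≤ t := by positivity
  have hsp : ‖a‖ = s ^ p := by
    rw [hs, ← Real.rpow_mul (norm_nonneg _), one_div_mul_cancel hp.ne', Real.rpow_one]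
  have htp : ‖b‖ = t ^ p := by
    rw [ht, ← Real.rpow_mul (norm_nonneg _), one_div_mul_cancel hp.ne', Real.rpow_one]
  have hpow {x : ℝ} (hx : 0 ≤ x) (n : ℕ) : (x ^ p) ^ n = (x ^ n) ^ p := by
    rw [← Real.rpow_natCast, ← Real.rpow_natCast, ← Real.rpow_mul hx, ← Real.rpow_mul hx,
      _root_.mul_comm]
  have key : ‖a + b‖ ≤ (s + t) ^ p := by
    refine le_of_forall_pow_two_pow_le (C := 1) (by positivity) fun m ↦ ?_
    rw [← h.norm_pow_two_pow, one_mul, (show Commute a b from h.mul_comm a b).add_pow]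
    set n := 2 ^ m
    refine (norm_sum_le_of_le (n := fun _ ↦ ((s + t) ^ p) ^ n) _ fun k hk ↦ ?_).trans_eq ?_
    · rw [← nsmul_eq_mul', ← Nat.cast_smul_eq_nsmul ℂ, h.norm_smul, Complex.norm_natCast,
        hpow (by positivity)]
      calc (n.choose k : ℝ) ^ p * ‖a ^ k * b ^ (n - k)‖
          ≤ (n.choose k : ℝ) ^ p * (‖a‖ ^ k * ‖b‖ ^ (n - k)) := by
            gcongr
            exact (norm_mul_le _ _).trans (mul_le_mul (h.norm_pow_le_pow _ _)
              (h.norm_pow_le_pow _ _) (norm_nonneg _) (by positivity))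
        _ = (s ^ k * t ^ (n - k) * n.choose k) ^ p := by
          rw [hsp, htp, hpow hs0, hpow ht0, Real.mul_rpow (by positivity) (by positivity),
            Real.mul_rpow (by positivity) (by positivity)]
          ring
        _ ≤ _ := by
          gcongr
          rw [add_pow]
          exact single_le_sum (f := fun k ↦ s ^ k * t ^ (n - k) * (n.choose k : ℝ))
            (fun _ _ ↦ by positivity) hk
    · simp
  calc ‖a + b‖ ^ (1 / p) ≤ ((s + t) ^ p) ^ (1 / p) := by gcongr
    _ = s + t := by
      rw [← Real.rpow_mul (by positivity), mul_one_div_cancel hp.ne', Real.rpow_one]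

theorem rpow_norm_sum_le (h : IsUniformPBanachAlgebra p A) {ι : Type*} (s : Finset ι) (b : ι → A) :
    ‖∑ i ∈ s, b i‖ ^ (1 / p) ≤ ∑ i ∈ s, ‖b i‖ ^ (1 / p) :=
  le_sum_of_subadditive (fun x : A ↦ ‖x‖ ^ (1 / p))
    (by simp [Real.zero_rpow (inv_pos.2 h.p_pos).ne']) h.rpow_norm_add_le s b

theorem supportSeminorm_eq (h : IsUniformPBanachAlgebra p A) (a : A) :
    supportSeminorm p a = ‖a‖ ^ (1 / p) := by
  refine IsLeast.csInf_eq ⟨⟨1, fun _ ↦ a, le_rfl, by simp, by simp⟩, ?_⟩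
  rintro _ ⟨n, b, -, rfl, rfl⟩
  exact h.rpow_norm_sum_le _ b

open Uniformity in
-- Lets the new norm keep the original uniform structure, hence completeness and the very same
-- character space.
theorem uniformity_eq_iInf_rpow_norm (h : IsUniformPBanachAlgebra p A) :
    𝓤 A = ⨅ ε > (0 : ℝ), Filter.principal {x : A × A | ‖x.1 - x.2‖ ^ (1 / p) < ε} := by
  have hp := h.p_pos
  have hq : 0 < 1 / p := by positivity
  rw [PseudoMetricSpace.uniformity_dist]
  refine le_antisymm (le_iInf₂ fun ε hε ↦ ?_) (le_iInf₂ fun ε hε ↦ ?_)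
  · refine iInf₂_le_of_le (ε ^ p) (Real.rpow_pos_of_pos hε p) (Filter.principal_mono.2 ?_)
    intro x hx
    rw [Set.mem_ofPred_eq, dist_eq_norm] at hx
    rw [Set.mem_ofPred_eq]
    calc ‖x.1 - x.2‖ ^ (1 / p) < (ε ^ p) ^ (1 / p) := Real.rpow_lt_rpow (norm_nonneg _) hx hq
      _ = ε := by rw [← Real.rpow_mul hε.le, mul_one_div_cancel hp.ne', Real.rpow_one]
  · refine iInf₂_le_of_le (ε ^ (1 / p)) (Real.rpow_pos_of_pos hε _) (Filter.principal_mono.2 ?_)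
    intro x hx
    rw [Set.mem_ofPred_eq] at hx
    rw [Set.mem_ofPred_eq, dist_eq_norm]
    exact (Real.rpow_lt_rpow_iff (norm_nonneg _) hε.le hq).1 hx

end IsUniformPBanachAlgebra

/-! ### Gelfand theory -/

/-- Along the exponents `2 ^ m`, the sequence in Gelfand's formula is constant. -/
theorem spectralRadius_eq_nnnorm_of_norm_sq {B : Type*} [NormedRing B] [NormedAlgebra ℂ B]
    [CompleteSpace B] (hsq : ∀ b : B, ‖b ^ 2‖ = ‖b‖ ^ 2) (b : B) :
    spectralRadius ℂ b = ‖b‖₊ := by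
  have hpow (m : ℕ) : ‖b ^ (2 ^ m)‖ = ‖b‖ ^ (2 ^ m) := by
    induction m with
    | zero => simp
    | succ m ih => rw [pow_succ, pow_mul, hsq, ih, pow_mul]
  have h1 := (spectrum.pow_norm_pow_one_div_tendsto_nhds_spectralRadius b).comp
    (tendsto_pow_atTop_atTop_of_one_lt (one_lt_two (α := ℕ)))
  refine tendsto_nhds_unique h1 (tendsto_const_nhds.congr fun m ↦ ?_)
  rw [Function.comp_apply, hpow, one_div, Real.pow_rpow_inv_natCast (norm_nonneg b) (by positivity),
    ofReal_norm, enorm_eq_nnnorm]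

theorem compactSpace_characterSpace {B : Type*} [NormedCommRing B] [NormedAlgebra ℂ B]
    [CompleteSpace B] : CompactSpace (WeakDual.characterSpace ℂ B) :=
  inferInstance

/-- The Gelfand transform of a commutative complex Banach algebra whose norm has the square
property is isometric. -/
theorem norm_gelfandTransform_of_norm_sq {B : Type*} [NormedCommRing B] [NormedAlgebra ℂ B]
    [CompleteSpace B] (hsq : ∀ b : B, ‖b ^ 2‖ = ‖b‖ ^ 2) (b : B) :
    ‖WeakDual.gelfandTransform ℂ B b‖ = ‖b‖ := by
  have h1 := spectralRadius_eq_nnnorm_of_norm_sq hsq b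
  -- The sup norm is a spectral radius, and the Gelfand transform preserves spectra.
  have h2 := IsStarNormal.spectralRadius_eq_nnnorm (WeakDual.gelfandTransform ℂ B b)
  rw [spectralRadius, spectrum.gelfandTransform_eq, ← spectralRadius, h1] at h2
  exact congrArg NNReal.toReal (ENNReal.coe_injective h2.symm)

namespace IsUniformPBanachAlgebra

variable {p : ℝ} {A : Type*} [NormedRing A] [Algebra ℂ A]

theorem rpow_norm_smul (h : IsUniformPBanachAlgebra p A) (c : ℂ) (a : A) :
    ‖c • a‖ ^ (1 / p) = ‖c‖ * ‖a‖ ^ (1 / p) := by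
  rw [h.norm_smul, Real.mul_rpow (by positivity) (by positivity),
    ← Real.rpow_mul (norm_nonneg _), mul_one_div_cancel h.p_pos.ne', Real.rpow_one]

/-- The Banach algebra norm `‖a‖ ^ (1 / p)` on a uniform `p`-Banach algebra, inducing its original
uniformity. -/
noncomputable abbrev rpowNormedCommRing (h : IsUniformPBanachAlgebra p A) : NormedCommRing A where
  __ := (inferInstance : Ring A)
  norm a := ‖a‖ ^ (1 / p)
  dist a b := ‖a - b‖ ^ (1 / p)
  dist_self a := by simp [Real.zero_rpow (inv_pos.2 h.p_pos).ne']
  dist_comm a b := by rw [norm_sub_rev]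
  dist_triangle a b c := by simpa using h.rpow_norm_add_le (a - b) (b - c)
  toUniformSpace := (inferInstance : UniformSpace A)
  uniformity_dist := h.uniformity_eq_iInf_rpow_norm
  eq_of_dist_eq_zero {a b} hab := by
    rwa [Real.rpow_eq_zero (norm_nonneg _) (one_div_pos.2 h.p_pos).ne', norm_sub_eq_zero_iff] at hab
  dist_eq a b := by rw [← norm_neg, neg_sub, sub_eq_neg_add]
  norm_mul_le a b := by
    rw [← Real.mul_rpow (norm_nonneg _) (norm_nonneg _)]
    exact Real.rpow_le_rpow (norm_nonneg _) (norm_mul_le a b) (one_div_pos.2 h.p_pos).le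
  mul_comm := h.mul_comm

/-- The normed algebra structure for the norm `‖a‖ ^ (1 / p)`. -/
noncomputable abbrev rpowNormedAlgebra (h : IsUniformPBanachAlgebra p A) :
    @NormedAlgebra ℂ A _ h.rpowNormedCommRing.toSeminormedCommRing.toSeminormedRing :=
  letI := h.rpowNormedCommRing
  { (inferInstance : Algebra ℂ A) with
    norm_smul_le := fun c a ↦ (h.rpow_norm_smul c a).le }

end IsUniformPBanachAlgebra

theorem corollary4p4 (p : ℝ) (A : Type*) [NormedRing A] [Algebra ℂ A]
    (hA : IsUniformPBanachAlgebra p A) :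
    ∃ _ : CompactSpace (WeakDual.characterSpace ℂ A),
      Function.Injective (WeakDual.gelfandTransform ℂ A) ∧
      ∀ a : A, supportSeminorm p a = ‖a‖ ^ (1 / p) ∧
        ‖a‖ ^ (1 / p) = ‖WeakDual.gelfandTransform ℂ A a‖ := by
  have hcomp := hA.complete
  have hcompact : CompactSpace (WeakDual.characterSpace ℂ A) :=
    @compactSpace_characterSpace A hA.rpowNormedCommRing hA.rpowNormedAlgebra hcomp
  have hnorm (a : A) : ‖WeakDual.gelfandTransform ℂ A a‖ = ‖a‖ ^ (1 / p) := by
    refine @norm_gelfandTransform_of_norm_sq A hA.rpowNormedCommRing hA.rpowNormedAlgebra hcomp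
      (fun b ↦ ?_) a
    change ‖b ^ 2‖ ^ (1 / p) = (‖b‖ ^ (1 / p)) ^ 2
    rw [hA.norm_sq, ← Real.rpow_natCast_mul (norm_nonneg _), mul_comm,
      Real.rpow_mul_natCast (norm_nonneg _)]
  refine ⟨hcompact, (injective_iff_map_eq_zero _).2 fun a ha ↦ ?_, fun a ↦
    ⟨hA.supportSeminorm_eq a, (hnorm a).symm⟩⟩
  have := hnorm a
  rwa [ha, norm_zero, eq_comm, Real.rpow_eq_zero (norm_nonneg _) (one_div_pos.2 hA.p_pos).ne',
    norm_eq_zero] at this
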